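/- Let $M,N,K$ be integers with $1\le N<M$, $K\ge 0$, and suppose $W=\frac{2K+1}{2M}<\frac12$. Let $B_{M,W}\in\mathbb{C}^{M\times M}$ be the matrix with entries $$B_{M,W}[m,n]=\frac{\sin(2\pi W(m-n))}{M\sin((m-n)\pi/M)},\qquad m,n\in\{0,\dots,M-1\},$$ where the diagonal entries ($m=n$) are understood as the limiting value $2W$. Let $[B_{M,W}]_N$ be its $N\times N$ leading principal submatrix, and let $\lambda_N^{(0)}\ge\lambda_N^{(1)}\ge\dots\ge\lambda_N^{(N-1)}$ be the eigenvalues of this Hermitian matrix, in decreasing order and with multiplicity. For $\epsilon\in(0,\frac12)$ put $$R=R(N,M,\epsilon)=\left(\frac{4}{\pi^2}\log(8N)+6\right)\log\left(\frac{16}{\epsilon}\right)+2\max\left(\frac{-\log\left(8\pi\left(\left(\frac MN\right)^2-1\right)\epsilon\right)}{\log\left(\frac MN\right)},\,0\right).$$ Then for every $\epsilon\in(0,\frac12)$: 1. $\lambda_N^{(\ell)}\ge 1-\epsilon$ for every $\ell\in\{0,\dots,N-1\}$ with $\ell\le 2\lfloor NW\rfloor-\lfloor R\rfloor$; 2. $\lambda_N^{(\ell)}\le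 \epsilon$ for every $\ell\in\{0,\dots,N-1\}$ with $\ell\ge 2\lfloor NW\rfloor+\lfloor R\rfloor+1$; 3. $\#\{\ell\in\{0,\dots,N-1\}:\epsilon<\lambda_N^{(\ell)}<1-\epsilon\}\le 2R$. -/

import Mathlib

noncomputable section

/-- The prolate (Dirichlet kernel) matrix `B_{M,W}` of size `M × M`. Its off-diagonal entries are
`sin (2πW(m-n)) / (M sin ((m-n)π/M))`; on the diagonal the quotient is `0 / 0` and has the
limiting value `2W`. -/
def prolateMatrix (M : ℕ) (W : ℝ) : Matrix (Fin M) (Fin M) ℂ :=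
  Matrix.of fun m n =>
    if m = n then ((2 * W : ℝ) : ℂ)
    else ((Real.sin (2 * Real.pi * W * ((m : ℝ) - (n : ℝ))) /
      (M * Real.sin (((m : ℝ) - (n : ℝ)) * Real.pi / M)) : ℝ) : ℂ)

/-- The `N × N` leading principal submatrix `[B_{M,W}]_N` of `B_{M,W}`, for `N ≤ M`. -/
def leadingProlate (N M : ℕ) (h : N ≤ M) (W : ℝ) : Matrix (Fin N) (Fin N) ℂ :=
  (prolateMatrix M W).submatrix (Fin.castLE h) (Fin.castLE h)

theorem prolateMatrix_isHermitian (M : ℕ) (W : ℝ) : (prolateMatrix M W).IsHermitian := by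
  ext m n
  simp only [prolateMatrix, Matrix.conjTranspose_apply, Matrix.of_apply]
  by_cases hmn : m = n
  · simp [hmn]
  · have hnm : ¬ n = m := fun e => hmn e.symm
    rw [if_neg hmn, if_neg hnm, Complex.star_def, Complex.conj_ofReal, ← neg_sub (m : ℝ) (n : ℝ)]
    simp only [mul_neg, neg_mul, neg_div, Real.sin_neg, neg_neg, div_neg]

theorem leadingProlate_isHermitian (N M : ℕ) (h : N ≤ M) (W : ℝ) :
    (leadingProlate N M h W).IsHermitian :=
  (prolateMatrix_isHermitian M W).submatrix _

/-- The eigenvalues `λ_N^{(0)} ≥ λ_N^{(1)} ≥ ⋯ ≥ λ_N^{(N-1)}` of `[B_{M,W}]_N`, in decreasing order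
and repeated according to multiplicity. -/
def prolateEigenvalue (N M : ℕ) (h : N ≤ M) (W : ℝ) (ℓ : Fin N) : ℝ :=
  (leadingProlate_isHermitian N M h W).eigenvalues₀ (Fin.cast (Fintype.card_fin N).symm ℓ)

/-- The half-width `R(N, M, ε)` of the transition band, a real number. -/
def transitionWidth (N M : ℕ) (ε : ℝ) : ℝ :=
  (4 / Real.pi ^ 2 * Real.log (8 * N) + 6) * Real.log (16 / ε) +
    2 * max (-Real.log (8 * Real.pi * (((M : ℝ) / N) ^ 2 - 1) * ε) / Real.log ((M : ℝ) / N)) 0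

end

/-!
Write `A` for the leading `N × N` block of the prolate matrix `B`, `M = N + P`, and `C` for the
`P × N` block of `B` below it.

`B` is the orthogonal projection onto the `2 K + 1` lowest discrete Fourier frequencies
(`prolateMatrix_mul_self`), so `A - A² = Cᴴ C` (`leadingProlate_eq`). Hence the eigenvalues `λ` of
`A` lie in `[0, 1]`, `∑ λ = 2 N W` is the trace, and in an eigenbasis `C` has squared column norms
`λ (1 - λ)`. Two estimates on `C` then decide everything.

* Few eigenvalues are in the transition band (`card_transition_le`). The
  entries of `C` are separable of rank two divided by `a j b' i + b j a' i`, with `a, b, a', b'`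
  sines whose ratios lie in `[1 / q, q]`, `q = 2 N + 1` (`offBlock_eq_cauchy`). For a node `p > 0`
  the Cayley factor `f = (a - p b) / (a + p b)` makes `C i j (1 - f' i * f j)` separable, so off a
  space of dimension two `C` agrees with `diag f' * C * diag f`. Using `J ≈ log N / log 5` nodes in
  geometric progression with ratio `25`, each `μ` times, brings the product of factors down to
  `(4 / 9) ^ μ` on the whole range, whence `‖C v‖² ≤ (2 / 3) ^ (8 μ) / 4 * ‖v‖²` off a space of
  dimension `2 μ J`; with `(2 / 3) ^ (8 μ) ≤ 2 ε` at most `2 μ J` eigenvalues satisfy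
  `ε < λ < 1 - ε`.
* The squared Frobenius norm `τ = ∑ λ (1 - λ)` of `C` is at most
  `(2 / π²) log N + 2` (`frobenius_offBlock_le`),
  by comparing `1 / sin²` with a telescoping difference of cotangents.

If `t` eigenvalues are in the transition band, comparing the indicator of `λ > ε` with `λ` itself
shows that the number of `λ > ε` and the number of `λ ≥ 1 - ε` both differ from the trace `2 N W`
by at most `τ / (1 - ε) + (1 - 2 ε) t` in the relevant direction (`card_gt_le_sum`,
`sum_le_card_ge`). This plus two, which absorbs the rounding of `2 N W`, is below the first summand
of the transition width (`location_error_add_two_le`); the second summand is nonnegative, and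
nothing more is needed about it.
-/

open Matrix Finset

/-! ### Spectral counting for a compression of a projection -/

theorem star_dotProduct_self_eq {n : Type*} [Fintype n] (v : n → ℂ) :
    star v ⬝ᵥ v = ((∑ i, ‖v i‖ ^ 2 : ℝ) : ℂ) := by
  simp only [dotProduct, Pi.star_apply, Complex.ofReal_sum]
  refine sum_congr rfl fun i _ => ?_
  rw [Complex.star_def, ← Complex.normSq_eq_conj_mul_self, Complex.normSq_eq_norm_sq]

theorem sum_norm_sq_mulVec {m n : Type*} [Fintype m] [Fintype n] (C : Matrix m n ℂ) (v : n → ℂ) :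
    ((∑ i, ‖(C *ᵥ v) i‖ ^ 2 : ℝ) : ℂ) = star v ⬝ᵥ ((Cᴴ * C) *ᵥ v) := by
  rw [← star_dotProduct_self_eq, star_mulVec, ← dotProduct_mulVec, mulVec_mulVec]

section Spectral

variable {m n : Type*} [Fintype m] [Fintype n] [DecidableEq n] {A : Matrix n n ℂ}

theorem star_mul_mul_eigenvectorUnitary (hA : A.IsHermitian) :
    (hA.eigenvectorUnitary : Matrix n n ℂ)ᴴ * A * (hA.eigenvectorUnitary : Matrix n n ℂ) =
      diagonal (fun i => (hA.eigenvalues i : ℂ)) := by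
  have h := hA.conjStarAlgAut_star_eigenvectorUnitary
  rw [Unitary.conjStarAlgAut_star_apply] at h
  exact h

/-- In an eigenbasis `U` of `A`, the Gram matrix of `C` is diagonal with entries `λ - λ²`. -/
theorem gram_mul_eigenvectorUnitary (hA : A.IsHermitian) (C : Matrix m n ℂ)
    (hC : A = A * A + Cᴴ * C) :
    (C * (hA.eigenvectorUnitary : Matrix n n ℂ))ᴴ * (C * (hA.eigenvectorUnitary : Matrix n n ℂ)) =
      diagonal (fun i => ((hA.eigenvalues i * (1 - hA.eigenvalues i) : ℝ) : ℂ)) := by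
  set U : Matrix n n ℂ := (hA.eigenvectorUnitary : Matrix n n ℂ) with hU
  have hUU : U * Uᴴ = 1 := Unitary.coe_mul_star_self hA.eigenvectorUnitary
  have hD : Uᴴ * A * U = diagonal (fun i => (hA.eigenvalues i : ℂ)) :=
    star_mul_mul_eigenvectorUnitary hA
  have hG : Cᴴ * C = A - A * A := by
    rw [eq_sub_iff_add_eq, add_comm]; exact hC.symm
  have h2 : Uᴴ * (A * A) * U = (Uᴴ * A * U) * (Uᴴ * A * U) := by
    calc Uᴴ * (A * A) * U = Uᴴ * A * 1 * A * U := by simp only [mul_one, Matrix.mul_assoc]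
      _ = _ := by rw [← hUU]; simp only [Matrix.mul_assoc]
  have h3 : (C * U)ᴴ * (C * U) = Uᴴ * (Cᴴ * C) * U := by
    rw [conjTranspose_mul]; simp only [Matrix.mul_assoc]
  rw [h3, hG, Matrix.mul_sub, Matrix.sub_mul, h2, hD, diagonal_mul_diagonal, diagonal_sub]
  congr 1
  ext i
  push_cast
  ring

/-- The energy of `C` on a combination of eigenvectors of `A`. -/
theorem sum_norm_sq_mulVec_eigenvectorUnitary (hA : A.IsHermitian) (C : Matrix m n ℂ)
    (hC : A = A * A + Cᴴ * C) (c : n → ℂ) :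
    ∑ i, ‖(C *ᵥ ((hA.eigenvectorUnitary : Matrix n n ℂ) *ᵥ c)) i‖ ^ 2 =
      ∑ i, hA.eigenvalues i * (1 - hA.eigenvalues i) * ‖c i‖ ^ 2 := by
  have h := sum_norm_sq_mulVec (C * (hA.eigenvectorUnitary : Matrix n n ℂ)) c
  rw [gram_mul_eigenvectorUnitary hA C hC, ← mulVec_mulVec] at h
  apply Complex.ofReal_injective
  rw [h]
  simp only [dotProduct, mulVec_diagonal, Pi.star_apply, Complex.ofReal_sum]
  refine sum_congr rfl fun i _ => ?_
  rw [Complex.ofReal_mul (_ * _), ← Complex.normSq_eq_norm_sq, Complex.normSq_eq_conj_mul_self,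
    Complex.star_def]
  ring

theorem sum_norm_sq_eigenvectorUnitary_mulVec (hA : A.IsHermitian) (c : n → ℂ) :
    ∑ i, ‖((hA.eigenvectorUnitary : Matrix n n ℂ) *ᵥ c) i‖ ^ 2 = ∑ i, ‖c i‖ ^ 2 := by
  have h := sum_norm_sq_mulVec (hA.eigenvectorUnitary : Matrix n n ℂ) c
  have hUU : (hA.eigenvectorUnitary : Matrix n n ℂ)ᴴ * (hA.eigenvectorUnitary : Matrix n n ℂ) = 1 :=
    Unitary.coe_star_mul_self hA.eigenvectorUnitary
  rw [hUU, one_mulVec, star_dotProduct_self_eq] at h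
  exact Complex.ofReal_injective h

theorem eigenvalues_mul_one_sub_nonneg (hA : A.IsHermitian) (C : Matrix m n ℂ)
    (hC : A = A * A + Cᴴ * C) (i : n) :
    0 ≤ hA.eigenvalues i * (1 - hA.eigenvalues i) := by
  have h := sum_norm_sq_mulVec_eigenvectorUnitary hA C hC (Pi.single i 1)
  have h0 : 0 ≤ ∑ j, hA.eigenvalues j * (1 - hA.eigenvalues j) *
      ‖(Pi.single i 1 : n → ℂ) j‖ ^ 2 := h ▸ sum_nonneg fun _ _ => by positivity
  rw [sum_eq_single i (by intro j _ hj; simp [hj]) (by simp)] at h0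
  simpa using h0

theorem sum_norm_sq_mulVec_le_quarter (hA : A.IsHermitian) (C : Matrix m n ℂ)
    (hC : A = A * A + Cᴴ * C) (v : n → ℂ) :
    ∑ i, ‖(C *ᵥ v) i‖ ^ 2 ≤ 1 / 4 * ∑ i, ‖v i‖ ^ 2 := by
  set U : Matrix n n ℂ := (hA.eigenvectorUnitary : Matrix n n ℂ) with hU
  have hUU : U * Uᴴ = 1 := Unitary.coe_mul_star_self hA.eigenvectorUnitary
  have hv : v = U *ᵥ (Uᴴ *ᵥ v) := by rw [mulVec_mulVec, hUU, one_mulVec]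
  rw [hv, sum_norm_sq_mulVec_eigenvectorUnitary hA C hC, sum_norm_sq_eigenvectorUnitary_mulVec,
    mul_sum]
  refine sum_le_sum fun i _ => mul_le_mul_of_nonneg_right ?_ (by positivity)
  nlinarith [sq_nonneg (hA.eigenvalues i - 1 / 2)]

theorem sum_eigenvalues_mul_one_sub (hA : A.IsHermitian) (C : Matrix m n ℂ)
    (hC : A = A * A + Cᴴ * C) :
    ∑ i, hA.eigenvalues i * (1 - hA.eigenvalues i) = ∑ j, ∑ i, ‖C j i‖ ^ 2 := by
  have h := congrArg trace (gram_mul_eigenvectorUnitary hA C hC)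
  have hUU : (hA.eigenvectorUnitary : Matrix n n ℂ) * (hA.eigenvectorUnitary : Matrix n n ℂ)ᴴ = 1 :=
    Unitary.coe_mul_star_self hA.eigenvectorUnitary
  rw [trace_mul_comm, conjTranspose_mul, Matrix.mul_assoc, ← Matrix.mul_assoc _ _ Cᴴ, hUU,
    Matrix.one_mul, trace_diagonal] at h
  apply Complex.ofReal_injective
  rw [Complex.ofReal_sum, ← h]
  simp only [trace, diag_apply, mul_apply, conjTranspose_apply, Complex.ofReal_sum]
  refine sum_congr rfl fun j _ => sum_congr rfl fun i _ => ?_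
  rw [← Complex.normSq_eq_norm_sq, Complex.normSq_eq_conj_mul_self, mul_comm, Complex.star_def]

/-- If `C` is small on the common kernel of `card κ` linear functionals, then at most `card κ`
eigenvalues of `A` have `λ (1 - λ)` large. -/
theorem card_eigenvalues_le (hA : A.IsHermitian) (C : Matrix m n ℂ)
    (hC : A = A * A + Cᴴ * C) {κ : Type*} [Fintype κ] (Φ : (n → ℂ) →ₗ[ℂ] (κ → ℂ)) {δ : ℝ}
    (hΦ : ∀ v, Φ v = 0 → ∑ i, ‖(C *ᵥ v) i‖ ^ 2 ≤ δ * ∑ i, ‖v i‖ ^ 2) (S : Finset n)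
    (hS : ∀ i ∈ S, δ < hA.eigenvalues i * (1 - hA.eigenvalues i)) :
    S.card ≤ Fintype.card κ := by
  by_contra! hlt
  let U : Matrix n n ℂ := (hA.eigenvectorUnitary : Matrix n n ℂ)
  let E : (S → ℂ) →ₗ[ℂ] (n → ℂ) := Function.ExtendByZero.linearMap ℂ (Subtype.val : S → n)
  have hE : ∀ (c : S → ℂ) (i : S), E c i = c i := fun c i =>
    Subtype.val_injective.extend_apply c 0 i
  have hE0 : ∀ (c : S → ℂ) (i : n), i ∉ S → E c i = 0 := fun c i hi =>
    Function.extend_apply' _ _ _ (by rintro ⟨j, rfl⟩; exact hi j.2)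
  let Ψ : (S → ℂ) →ₗ[ℂ] (κ → ℂ) := Φ ∘ₗ (mulVecLin U) ∘ₗ E
  have hker : LinearMap.ker Ψ ≠ ⊥ := LinearMap.ker_ne_bot_of_finrank_lt (by simpa using hlt)
  obtain ⟨c, hc, hc0⟩ := (Submodule.ne_bot_iff _).1 hker
  have h := hΦ (U *ᵥ E c) hc
  rw [sum_norm_sq_mulVec_eigenvectorUnitary hA C hC, sum_norm_sq_eigenvectorUnitary_mulVec,
    mul_sum] at h
  obtain ⟨i, hi⟩ := Function.ne_iff.1 hc0
  refine absurd h (not_le.2 (sum_lt_sum (fun j _ => ?_) ⟨i, mem_univ _, ?_⟩))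
  · by_cases hj : j ∈ S
    · exact mul_le_mul_of_nonneg_right (hS j hj).le (by positivity)
    · simp [hE0 c j hj]
  · rw [hE]
    exact mul_lt_mul_of_pos_right (hS i i.2) (by have := norm_pos_iff.2 hi; positivity)

end Spectral

/-- A value `l ∈ [0, 1]` differs from the indicator of `ε < l` by at most a multiple of `l (1 - l)`,
up to a correction on the transition band. -/
theorem indicator_sub_le {ε l : ℝ} (h0 : 0 < ε) (h1 : ε < 1 / 2) (hl0 : 0 ≤ l) (hl1 : l ≤ 1) :
    (if ε < l then (1 : ℝ) else 0) - l ≤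
      l * (1 - l) / (1 - ε) + (1 - 2 * ε) * (if ε < l ∧ l < 1 - ε then 1 else 0) := by
  have he : 0 < 1 - ε := by linarith
  have hq : 0 ≤ l * (1 - l) / (1 - ε) := div_nonneg (mul_nonneg hl0 (by linarith)) he.le
  by_cases h : ε < l
  · by_cases h' : l < 1 - ε
    · rw [if_pos h, if_pos ⟨h, h'⟩]
      rw [← sub_le_iff_le_add, le_div_iff₀ he]
      nlinarith [mul_pos (sub_pos.2 h) (sub_pos.2 h'), mul_pos (sub_pos.2 h) h0]
    · rw [if_pos h, if_neg (fun hh => h' hh.2), mul_zero, add_zero, le_div_iff₀ he]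
      nlinarith
  · rw [if_neg h, if_neg (fun hh => h hh.1)]
    linarith

/-- Counting values above `ε` through their sum. -/
theorem card_gt_le_sum {n : Type*} [Fintype n] {ε : ℝ} (h0 : 0 < ε) (h1 : ε < 1 / 2) (l : n → ℝ)
    (hl0 : ∀ i, 0 ≤ l i) (hl1 : ∀ i, l i ≤ 1) :
    ((univ.filter fun i => ε < l i).card : ℝ) ≤ ∑ i, l i + ((∑ i, l i * (1 - l i)) / (1 - ε) +
      (1 - 2 * ε) * (univ.filter fun i => ε < l i ∧ l i < 1 - ε).card) := by
  have h := sum_le_sum fun i (_ : i ∈ (univ : Finset n)) => indicator_sub_le h0 h1 (hl0 i) (hl1 i)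
  rw [sum_sub_distrib, sum_add_distrib, ← sum_div, ← mul_sum, sum_boole, sum_boole] at h
  linarith

/-- Counting values at least `1 - ε` through their sum. -/
theorem sum_le_card_ge {n : Type*} [Fintype n] {ε : ℝ} (h0 : 0 < ε) (h1 : ε < 1 / 2) (l : n → ℝ)
    (hl0 : ∀ i, 0 ≤ l i) (hl1 : ∀ i, l i ≤ 1) :
    ∑ i, l i ≤ (univ.filter fun i => 1 - ε ≤ l i).card + ((∑ i, l i * (1 - l i)) / (1 - ε) +
      (1 - 2 * ε) * (univ.filter fun i => ε < l i ∧ l i < 1 - ε).card) := by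
  have h := card_gt_le_sum h0 h1 (fun i => 1 - l i) (fun i => by linarith [hl1 i])
    (fun i => by linarith [hl0 i])
  have e1 : (univ.filter fun i => ε < 1 - l i ∧ 1 - l i < 1 - ε) =
      univ.filter fun i => ε < l i ∧ l i < 1 - ε := by
    ext i; simp only [mem_filter, mem_univ, true_and]
    constructor <;> rintro ⟨a, b⟩ <;> constructor <;> linarith
  have e2 : (univ.filter fun i => ε < 1 - l i) = univ.filter fun i => ¬ (1 - ε ≤ l i) := by
    ext i; simp only [mem_filter, mem_univ, true_and, not_le]
    constructor <;> intro a <;> linarith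
  have e3 := card_filter_add_card_filter_not (s := (univ : Finset n)) (fun i => 1 - ε ≤ l i)
  have e4 : ∑ i, (1 - l i) * (1 - (1 - l i)) = ∑ i, l i * (1 - l i) :=
    sum_congr rfl fun i _ => by ring
  have e5 : ∑ i, (1 - l i) = (univ : Finset n).card - ∑ i, l i := by
    rw [sum_sub_distrib]; simp
  rw [e1, e2, e4, e5, ← e3] at h
  push_cast at h
  linarith

/-! ### Cauchy-like matrices and Cayley factors -/

/-- The Cayley factor `(a - p b) / (a + p b)` with node `p`, as a function of the homogeneous
coordinate `a / b`. -/
noncomputable def cayley (p a b : ℝ) : ℝ := (a - p * b) / (a + p * b)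

theorem abs_cayley_le_one {p a b : ℝ} (hp : 0 < p) (ha : 0 < a) (hb : 0 < b) :
    |cayley p a b| ≤ 1 := by
  have : 0 < p * b := mul_pos hp hb
  rw [cayley, abs_div, abs_of_pos (by linarith : 0 < a + p * b), div_le_one (by linarith), abs_le]
  constructor <;> linarith

/-- Two consecutive nodes `p` and `25 p` enclosing `a / b` together contract by `4 / 9`. -/
theorem abs_cayley_mul_cayley_le {p a b : ℝ} (hp : 0 < p) (ha : 0 < a) (hb : 0 < b)
    (h1 : p * b ≤ a) (h2 : a ≤ 25 * p * b) :
    |cayley p a b| * |cayley (25 * p) a b| ≤ 4 / 9 := by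
  have h3 : 0 < p * b := mul_pos hp hb
  rw [cayley, cayley, abs_div, abs_div, abs_of_nonneg (sub_nonneg.2 h1),
    abs_of_nonpos (sub_nonpos.2 h2), abs_of_pos (by linarith : 0 < a + p * b),
    abs_of_pos (by linarith : 0 < a + 25 * p * b), div_mul_div_comm,
    div_le_div_iff₀ (mul_pos (by linarith) (by linarith)) (by norm_num)]
  nlinarith [sq_nonneg (a - 5 * (p * b))]

/-- The `J` nodes `25 ^ j / q` cover the range `[1 / q, q]` of `a / b`. -/
theorem abs_prod_cayley_le {q a b : ℝ} {J : ℕ} (hq : 0 < q) (ha : 0 < a) (hb : 0 < b)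
    (hab : a ≤ q * b) (hba : b ≤ q * a) (hJ : q ^ 2 < 25 ^ (J - 1)) :
    |∏ j ∈ range J, cayley (25 ^ j / q) a b| ≤ 4 / 9 := by
  have hex : ∃ j, q * a < 25 ^ j * b := by
    refine ⟨J - 1, ?_⟩
    have : q * a ≤ q ^ 2 * b := by nlinarith
    exact this.trans_lt (mul_lt_mul_of_pos_right hJ hb)
  classical
  -- `i`, `i + 1` are the exponents of the two nodes enclosing `a / b`
  obtain ⟨i, hi⟩ : ∃ i, Nat.find hex = i + 1 := by
    refine Nat.exists_eq_succ_of_ne_zero fun h0 => ?_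
    have := Nat.find_spec hex
    rw [h0, pow_zero, one_mul] at this
    linarith
  have hi1 : q * a < 25 ^ (i + 1) * b := hi ▸ Nat.find_spec hex
  have hi0 : 25 ^ i * b ≤ q * a := not_lt.1 (Nat.find_min hex (hi ▸ Nat.lt_succ_self i))
  have hiJ : i + 1 ≤ J - 1 := by
    rw [← hi]
    refine Nat.find_min' hex ?_
    have : q * a ≤ q ^ 2 * b := by nlinarith
    exact this.trans_lt (mul_lt_mul_of_pos_right hJ hb)
  rw [abs_prod]
  have hsub : ({i, i + 1} : Finset ℕ) ⊆ range J := by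
    intro x hx; simp only [mem_insert, mem_singleton] at hx; rw [mem_range]; omega
  rw [← prod_sdiff hsub, prod_pair (by omega)]
  have hpair : |cayley (25 ^ i / q) a b| * |cayley (25 ^ (i + 1) / q) a b| ≤ 4 / 9 := by
    have e : (25 : ℝ) ^ (i + 1) / q = 25 * (25 ^ i / q) := by ring
    rw [e]
    refine abs_cayley_mul_cayley_le (by positivity) ha hb ?_ ?_
    · rw [div_mul_eq_mul_div, div_le_iff₀ hq]; linarith
    · rw [← e, div_mul_eq_mul_div, le_div_iff₀ hq]; linarith
  calc _ ≤ 1 * (4 / 9 : ℝ) := by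
        refine mul_le_mul ?_ hpair (by positivity) zero_le_one
        exact prod_le_one (fun _ _ => abs_nonneg _)
          fun j _ => abs_cayley_le_one (by positivity) ha hb
    _ = 4 / 9 := one_mul _

theorem prod_range_mul_mod {M : Type*} [CommMonoid M] (g : ℕ → M) (μ J : ℕ) :
    ∏ i ∈ range (μ * J), g (i % J) = (∏ i ∈ range J, g i) ^ μ := by
  induction μ with
  | zero => simp
  | succ k ih =>
    rw [add_mul, one_mul, prod_range_add, ih, pow_succ]
    congr 1
    refine prod_congr rfl fun i hi => ?_
    rw [Nat.mul_add_mod_of_lt (mem_range.1 hi)]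

theorem cauchy_sub_cayley_mul {F : Type*} [Field F] {a b a' b' p : F} (h1 : a * b' + b * a' ≠ 0)
    (h2 : a' + p * b' ≠ 0) (h3 : a + p * b ≠ 0) (S u : F) :
    S / (a * b' + b * a') * u -
      (a' - p * b') / (a' + p * b') * (S / (a * b' + b * a') * ((a - p * b) / (a + p * b) * u)) =
      S * (2 * p / ((a' + p * b') * (a + p * b)) * u) := by
  have e : 1 - (a' - p * b') / (a' + p * b') * ((a - p * b) / (a + p * b)) =
      (a * b' + b * a') * (2 * p / ((a' + p * b') * (a + p * b))) := by
    rw [div_mul_div_comm, one_sub_div (mul_ne_zero h2 h3), ← mul_div_assoc]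
    congr 1
    ring
  calc _ = S / (a * b' + b * a') * u *
        (1 - (a' - p * b') / (a' + p * b') * ((a - p * b) / (a + p * b))) := by ring
    _ = S * ((a * b' + b * a') / (a * b' + b * a')) *
        (2 * p / ((a' + p * b') * (a + p * b)) * u) := by rw [e]; ring
    _ = _ := by rw [div_self h1, mul_one]

section LowRank

variable {m n σ : Type*} [Fintype n] [Fintype σ] {C : Matrix m n ℂ}
  {a b : n → ℝ} {a' b' : m → ℝ} {ξ : m → σ → ℂ} {η : n → σ → ℂ}

/-- One step of the factorisation: on the common kernel of the functionals
`u ↦ ∑ j, η j s u j / (a j + p b j)`, conjugating a Cauchy-like matrix by the Cayley factors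
does not change it, because `C i j (1 - cayley i cayley j)` is separable. -/
theorem mulVec_eq_cayley_mul (ha : ∀ j, 0 < a j) (hb : ∀ j, 0 < b j) (ha' : ∀ i, 0 < a' i)
    (hb' : ∀ i, 0 < b' i)
    (hC : ∀ i j, C i j = (∑ s, ξ i s * η j s) / ((a j * b' i + b j * a' i : ℝ) : ℂ))
    {p : ℝ} (hp : 0 < p) (u : n → ℂ)
    (hu : ∀ s, ∑ j, η j s / ((a j + p * b j : ℝ) : ℂ) * u j = 0) (i : m) :
    (C *ᵥ u) i = (cayley p (a' i) (b' i) : ℂ) *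
      (C *ᵥ fun j => (cayley p (a j) (b j) : ℂ) * u j) i := by
  have key : ∀ j, C i j * u j - (cayley p (a' i) (b' i) : ℂ) *
      (C i j * ((cayley p (a j) (b j) : ℂ) * u j)) =
      ∑ s, (2 * p / ((a' i + p * b' i : ℝ) : ℂ) * ξ i s) *
        (η j s / ((a j + p * b j : ℝ) : ℂ) * u j) := by
    intro j
    have h1 : ((a j * b' i + b j * a' i : ℝ) : ℂ) ≠ 0 := by
      have := mul_pos (ha j) (hb' i); have := mul_pos (hb j) (ha' i)
      exact Complex.ofReal_ne_zero.2 (by linarith)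
    have h2 : ((a' i + p * b' i : ℝ) : ℂ) ≠ 0 := by
      have := mul_pos hp (hb' i)
      exact Complex.ofReal_ne_zero.2 (by linarith [ha' i])
    have h3 : ((a j + p * b j : ℝ) : ℂ) ≠ 0 := by
      have := mul_pos hp (hb j)
      exact Complex.ofReal_ne_zero.2 (by linarith [ha j])
    have e : ∑ s, (2 * p / ((a' i + p * b' i : ℝ) : ℂ) * ξ i s) *
        (η j s / ((a j + p * b j : ℝ) : ℂ) * u j) = (∑ s, ξ i s * η j s) *
        (2 * p / (((a' i + p * b' i : ℝ) : ℂ) * ((a j + p * b j : ℝ) : ℂ)) * u j) := by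
      rw [sum_mul]
      refine sum_congr rfl fun s _ => ?_
      field_simp
    rw [e, hC, cayley, cayley]
    push_cast at h1 h2 h3 ⊢
    exact cauchy_sub_cayley_mul h1 h2 h3 _ _
  simp only [mulVec, dotProduct]
  rw [← sub_eq_zero, mul_sum, ← sum_sub_distrib, sum_congr rfl fun j _ => key j, sum_comm]
  refine sum_eq_zero fun s _ => ?_
  rw [← mul_sum, hu s, mul_zero]

/-- Iteration of `mulVec_eq_cayley_mul` over the nodes `p 0, …, p (k - 1)`. -/
theorem mulVec_eq_prod_cayley_mul (ha : ∀ j, 0 < a j) (hb : ∀ j, 0 < b j) (ha' : ∀ i, 0 < a' i)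
    (hb' : ∀ i, 0 < b' i)
    (hC : ∀ i j, C i j = (∑ s, ξ i s * η j s) / ((a j * b' i + b j * a' i : ℝ) : ℂ))
    (p : ℕ → ℝ) (hp : ∀ k, 0 < p k) (u : n → ℂ) (k : ℕ)
    (hu : ∀ l < k, ∀ s, ∑ j, η j s / ((a j + p l * b j : ℝ) : ℂ) *
      (((∏ t ∈ range l, cayley (p t) (a j) (b j) : ℝ) : ℂ) * u j) = 0) (i : m) :
    (C *ᵥ u) i = ((∏ t ∈ range k, cayley (p t) (a' i) (b' i) : ℝ) : ℂ) *
      (C *ᵥ fun j => ((∏ t ∈ range k, cayley (p t) (a j) (b j) : ℝ) : ℂ) * u j) i := by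
  induction k with
  | zero => simp
  | succ k ih =>
    rw [ih fun l hl => hu l (hl.trans (Nat.lt_succ_self k)),
      mulVec_eq_cayley_mul ha hb ha' hb' hC (hp k) _ (hu k (Nat.lt_succ_self k)) i, ← mul_assoc]
    congr 1
    · rw [prod_range_succ, Complex.ofReal_mul]
    · congr 2
      funext j
      rw [prod_range_succ, Complex.ofReal_mul]
      ring

/-- A Cauchy-like matrix with at most quarter energy, whose coordinates `a / b` all lie in
`[1 / q, q]`, is small off a space of dimension `card σ * (μ * J)`. -/
theorem exists_linearMap_energy_le [Fintype m] (ha : ∀ j, 0 < a j) (hb : ∀ j, 0 < b j) (ha' : ∀ i, 0 < a' i)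
    (hb' : ∀ i, 0 < b' i)
    (hC : ∀ i j, C i j = (∑ s, ξ i s * η j s) / ((a j * b' i + b j * a' i : ℝ) : ℂ))
    (hquarter : ∀ v, ∑ i, ‖(C *ᵥ v) i‖ ^ 2 ≤ 1 / 4 * ∑ j, ‖v j‖ ^ 2)
    {q : ℝ} (hq : 0 < q) (hab : ∀ j, a j ≤ q * b j) (hba : ∀ j, b j ≤ q * a j)
    (hab' : ∀ i, a' i ≤ q * b' i) (hba' : ∀ i, b' i ≤ q * a' i) (μ J : ℕ)
    (hJ : q ^ 2 < 25 ^ (J - 1)) :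
    ∃ Φ : (n → ℂ) →ₗ[ℂ] (Fin (μ * J) × σ → ℂ), ∀ v, Φ v = 0 →
      ∑ i, ‖(C *ᵥ v) i‖ ^ 2 ≤ 1 / 4 * ((4 / 9) ^ μ) ^ 4 * ∑ j, ‖v j‖ ^ 2 := by
  let p : ℕ → ℝ := fun t => 25 ^ (t % J) / q
  have hp : ∀ t, 0 < p t := fun t => by positivity
  let r : ℕ → ℝ → ℝ → ℝ := fun k x y => ∏ t ∈ range k, cayley (p t) x y
  have hr : ∀ x y, 0 < x → 0 < y → x ≤ q * y → y ≤ q * x → |r (μ * J) x y| ≤ (4 / 9) ^ μ := by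
    intro x y hx hy hxy hyx
    have e : r (μ * J) x y = (∏ j ∈ range J, cayley (25 ^ j / q) x y) ^ μ :=
      prod_range_mul_mod (fun j => cayley (25 ^ j / q) x y) μ J
    rw [e, abs_pow]
    exact pow_le_pow_left₀ (abs_nonneg _) (abs_prod_cayley_le hq hx hy hxy hyx hJ) μ
  let G : Matrix (Fin (μ * J) × σ) n ℂ := Matrix.of fun ls j =>
    η j ls.2 / ((a j + p ls.1 * b j : ℝ) : ℂ) * ((r ls.1 (a j) (b j) : ℝ) : ℂ)
  refine ⟨mulVecLin G, fun v hv => ?_⟩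
  have hCv := mulVec_eq_prod_cayley_mul ha hb ha' hb' hC p hp v (μ * J) (by
    intro l hl s
    have h := congrFun hv (⟨l, hl⟩, s)
    simp only [mulVecLin_apply, mulVec, dotProduct, G, Matrix.of_apply, Pi.zero_apply,
      mul_assoc] at h
    exact h)
  have hsq : ∀ x : ℝ, |x| ≤ (4 / 9) ^ μ → x ^ 2 ≤ ((4 / 9) ^ μ) ^ 2 := fun x hx => by
    rw [← sq_abs]; exact pow_le_pow_left₀ (abs_nonneg _) hx 2
  have hscale : ∀ (x : ℝ) (z : ℂ), |x| ≤ (4 / 9) ^ μ →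
      ‖(x : ℂ) * z‖ ^ 2 ≤ ((4 / 9) ^ μ) ^ 2 * ‖z‖ ^ 2 := fun x z hx => by
    rw [norm_mul, mul_pow, Complex.norm_real, Real.norm_eq_abs, sq_abs]
    exact mul_le_mul_of_nonneg_right (hsq x hx) (by positivity)
  calc ∑ i, ‖(C *ᵥ v) i‖ ^ 2
      ≤ ∑ i, ((4 / 9) ^ μ) ^ 2 * ‖(C *ᵥ fun j => ((r (μ * J) (a j) (b j) : ℝ) : ℂ) * v j) i‖ ^ 2 :=
        sum_le_sum fun i _ => by
          rw [hCv i]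
          exact hscale _ _ (hr _ _ (ha' i) (hb' i) (hab' i) (hba' i))
    _ ≤ ((4 / 9) ^ μ) ^ 2 * (1 / 4 * ∑ j, ‖((r (μ * J) (a j) (b j) : ℝ) : ℂ) * v j‖ ^ 2) := by
        rw [← mul_sum]
        exact mul_le_mul_of_nonneg_left (hquarter _) (by positivity)
    _ ≤ ((4 / 9) ^ μ) ^ 2 * (1 / 4 * ∑ j, ((4 / 9) ^ μ) ^ 2 * ‖v j‖ ^ 2) := by
        gcongr with j
        exact hscale _ _ (hr _ _ (ha j) (hb j) (hab j) (hba j))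
    _ = _ := by rw [← mul_sum]; ring

end LowRank

/-! ### The prolate matrix as a projection -/

/-- The Dirichlet kernel, multiplied through by its denominator. -/
theorem sum_exp_mul_sin (K : ℕ) (x : ℝ) :
    (∑ j ∈ range (2 * K + 1), Complex.exp (2 * (j - K) * x * Complex.I)) * Real.sin x =
      Real.sin ((2 * K + 1) * x) := by
  have h := sum_range_sub
    (fun j : ℕ => Complex.exp ((2 * j - 1 - 2 * K) * x * Complex.I)) (2 * K + 1)
  have e : ∀ j : ℕ, Complex.exp ((2 * ((j + 1 : ℕ) : ℂ) - 1 - 2 * K) * x * Complex.I) -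
      Complex.exp ((2 * (j : ℂ) - 1 - 2 * K) * x * Complex.I) =
      Complex.exp (2 * (j - K) * x * Complex.I) * (2 * Complex.I * Real.sin x) := by
    intro j
    have h2 : 2 * Complex.I * Real.sin x =
        Complex.exp (x * Complex.I) - Complex.exp (-x * Complex.I) := by
      rw [Complex.ofReal_sin, Complex.sin]
      linear_combination (Complex.exp (-x * Complex.I) - Complex.exp (x * Complex.I)) *
        Complex.I_sq
    rw [h2, mul_sub, ← Complex.exp_add, ← Complex.exp_add]
    congr 2 <;> push_cast <;> ring
  simp only [e] at h
  rw [← sum_mul] at h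
  have h3 : 2 * Complex.I * Real.sin ((2 * K + 1) * x) =
      Complex.exp ((2 * ((2 * K + 1 : ℕ) : ℂ) - 1 - 2 * K) * x * Complex.I) -
        Complex.exp ((2 * ((0 : ℕ) : ℂ) - 1 - 2 * K) * x * Complex.I) := by
    have e1 : (2 * ((2 * K + 1 : ℕ) : ℂ) - 1 - 2 * K) * x * Complex.I =
      (((2 * K + 1) * x : ℝ) : ℂ) * Complex.I := by push_cast; ring
    have e2 : (2 * ((0 : ℕ) : ℂ) - 1 - 2 * K) * x * Complex.I =
      -(((2 * K + 1) * x : ℝ) : ℂ) * Complex.I := by push_cast; ring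
    rw [e1, e2, Complex.ofReal_sin, Complex.sin]
    linear_combination (Complex.exp (-(((2 * K + 1) * x : ℝ) : ℂ) * Complex.I) -
      Complex.exp ((((2 * K + 1) * x : ℝ) : ℂ) * Complex.I)) * Complex.I_sq
  rw [← h3] at h
  have hI : 2 * Complex.I ≠ 0 := mul_ne_zero two_ne_zero Complex.I_ne_zero
  apply mul_left_cancel₀ hI
  rw [← h]
  ring

theorem sin_mul_pi_div_ne_zero {M : ℕ} {m n : Fin M} (h : m ≠ n) :
    Real.sin (((m : ℝ) - n) * Real.pi / M) ≠ 0 := by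
  have hM : (0 : ℝ) < M := by exact_mod_cast m.pos
  have hm : (m : ℝ) < M := by exact_mod_cast m.2
  have hn : (n : ℝ) < M := by exact_mod_cast n.2
  have hm0 : (0 : ℝ) ≤ m := by positivity
  have hn0 : (0 : ℝ) ≤ n := by positivity
  have hpi := Real.pi_pos
  intro h0
  have h1 : ((m : ℝ) - n) * Real.pi / M = 0 := by
    refine (Real.sin_eq_zero_iff_of_lt_of_lt ?_ ?_).1 h0
    · rw [lt_div_iff₀ hM]; nlinarith
    · rw [div_lt_iff₀ hM]; nlinarith
  rw [div_eq_zero_iff, mul_eq_zero] at h1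
  rcases h1 with (h1 | h1) | h1
  · exact h (Fin.ext (by exact_mod_cast sub_eq_zero.1 h1))
  · exact hpi.ne' h1
  · exact hM.ne' h1

/-- The matrix whose columns are the `2K + 1` lowest discrete Fourier frequencies, unnormalised. -/
noncomputable def fourierColumns (M K : ℕ) : Matrix (Fin M) (Fin (2 * K + 1)) ℂ :=
  Matrix.of fun m j => Complex.exp (2 * ((j : ℕ) - K) * (((m : ℕ) * Real.pi / M : ℝ) : ℂ) *
    Complex.I)

theorem prolateMatrix_eq_fourierColumns (M K : ℕ) {W : ℝ}
    (hW : W = (2 * (K : ℝ) + 1) / (2 * (M : ℝ))) :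
    prolateMatrix M W = (M : ℂ)⁻¹ • (fourierColumns M K * (fourierColumns M K)ᴴ) := by
  ext m n
  have hM : (M : ℝ) ≠ 0 := by exact_mod_cast m.pos.ne'
  have hMC : (M : ℂ) ≠ 0 := by exact_mod_cast m.pos.ne'
  have hF : (fourierColumns M K * (fourierColumns M K)ᴴ) m n =
      ∑ j ∈ range (2 * K + 1), Complex.exp (2 * (j - K) *
        ((((m : ℝ) - n) * Real.pi / M : ℝ) : ℂ) * Complex.I) := by
    rw [mul_apply, ← Fin.sum_univ_eq_sum_range
      (fun j : ℕ => Complex.exp (2 * ((j : ℂ) - K) *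
        ((((m : ℝ) - n) * Real.pi / M : ℝ) : ℂ) * Complex.I))]
    refine sum_congr rfl fun j _ => ?_
    rw [conjTranspose_apply, fourierColumns, Matrix.of_apply, Matrix.of_apply, Complex.star_def,
      ← Complex.exp_conj, ← Complex.exp_add]
    congr 1
    simp only [map_mul, map_sub, Complex.conj_ofReal, Complex.conj_I, Complex.conj_natCast,
      Complex.conj_ofNat]
    push_cast
    ring
  rw [Matrix.smul_apply, hF, smul_eq_mul, prolateMatrix, Matrix.of_apply]
  by_cases h : m = n
  · subst h
    rw [if_pos rfl, hW]
    simp only [sub_self, zero_mul, zero_div, Complex.ofReal_zero, mul_zero, Complex.exp_zero,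
      sum_const, card_range, nsmul_eq_mul, mul_one]
    push_cast
    field_simp
  · have hs := sin_mul_pi_div_ne_zero h
    rw [if_neg h]
    have hD := sum_exp_mul_sin K (((m : ℝ) - n) * Real.pi / M)
    have harg : 2 * Real.pi * W * ((m : ℝ) - n) =
        (2 * K + 1) * (((m : ℝ) - n) * Real.pi / M) := by
      rw [hW]; field_simp
    rw [harg, Complex.ofReal_div, ← hD, Complex.ofReal_mul]
    have hsC : (Real.sin (((m : ℝ) - n) * Real.pi / M) : ℂ) ≠ 0 := Complex.ofReal_ne_zero.2 hs
    rw [Complex.ofReal_natCast, mul_div_mul_right _ _ hsC, div_eq_inv_mul]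

theorem fourierColumns_gram {M K : ℕ} (h : 2 * K + 1 ≤ M) :
    (fourierColumns M K)ᴴ * fourierColumns M K = (M : ℂ) • 1 := by
  have hM : M ≠ 0 := by omega
  have hMC : (M : ℂ) ≠ 0 := by exact_mod_cast hM
  have hζ := Complex.isPrimitiveRoot_exp M hM
  set ζ := Complex.exp (2 * Real.pi * Complex.I / M) with hζd
  ext i j
  have hsum : ((fourierColumns M K)ᴴ * fourierColumns M K) i j =
      ∑ m ∈ range M, (ζ ^ ((j : ℤ) - i)) ^ m := by
    rw [mul_apply, ← Fin.sum_univ_eq_sum_range (fun m : ℕ => (ζ ^ ((j : ℤ) - i)) ^ m)]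
    refine sum_congr rfl fun m _ => ?_
    rw [conjTranspose_apply, fourierColumns, Matrix.of_apply, Matrix.of_apply, Complex.star_def,
      ← Complex.exp_conj, ← Complex.exp_add, hζd, ← Complex.exp_int_mul, ← Complex.exp_nat_mul]
    congr 1
    simp only [map_mul, map_sub, Complex.conj_ofReal, Complex.conj_I, Complex.conj_natCast,
      Complex.conj_ofNat]
    push_cast
    field_simp
    ring
  rw [hsum, Matrix.smul_apply, smul_eq_mul]
  by_cases hij : i = j
  · subst hij
    simp
  · rw [one_apply_ne hij, mul_zero]
    have hne : ζ ^ ((j : ℤ) - i) ≠ 1 := by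
      intro h1
      have hd := (hζ.zpow_eq_one_iff_dvd _).1 h1
      have hi := i.2
      have hj := j.2
      have h0 := Int.eq_zero_of_abs_lt_dvd hd (by rw [abs_lt]; constructor <;> omega)
      exact hij (Fin.ext (by omega))
    have hpow : (ζ ^ ((j : ℤ) - i)) ^ M = 1 := by
      rw [← zpow_natCast, ← _root_.zpow_mul, mul_comm, _root_.zpow_mul, zpow_natCast, hζ.pow_eq_one, _root_.one_zpow]
    rw [geom_sum_eq hne, hpow, sub_self, zero_div]

/-- The prolate matrix is the orthogonal projection onto the low frequencies. -/
theorem prolateMatrix_mul_self {M K : ℕ} {W : ℝ} (h : 2 * K + 1 ≤ M)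
    (hW : W = (2 * (K : ℝ) + 1) / (2 * (M : ℝ))) :
    prolateMatrix M W * prolateMatrix M W = prolateMatrix M W := by
  have hMC : (M : ℂ) ≠ 0 := by exact_mod_cast (by omega : M ≠ 0)
  rw [prolateMatrix_eq_fourierColumns M K hW]
  set F := fourierColumns M K with hF
  have e : F * Fᴴ * (F * Fᴴ) = (M : ℂ) • (F * Fᴴ) := by
    calc F * Fᴴ * (F * Fᴴ) = F * (Fᴴ * F) * Fᴴ := by simp only [Matrix.mul_assoc]
      _ = _ := by
        rw [hF, fourierColumns_gram h, Matrix.mul_smul, Matrix.smul_mul, Matrix.mul_one]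
  rw [Matrix.smul_mul, Matrix.mul_smul, e, smul_smul, smul_smul]
  congr 1
  field_simp

/-- The block of the prolate matrix with rows beyond `N` and columns before `N`. -/
noncomputable def offBlock (N P : ℕ) (W : ℝ) : Matrix (Fin P) (Fin N) ℂ :=
  (prolateMatrix (N + P) W).submatrix (Fin.natAdd N) (Fin.castAdd P)

theorem leadingProlate_eq {N P K : ℕ} {W : ℝ} (h : 2 * K + 1 ≤ N + P)
    (hW : W = (2 * (K : ℝ) + 1) / (2 * ((N + P : ℕ) : ℝ))) (hle : N ≤ N + P) :
    leadingProlate N (N + P) hle W =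
      leadingProlate N (N + P) hle W * leadingProlate N (N + P) hle W +
        (offBlock N P W)ᴴ * offBlock N P W := by
  ext i j
  have h1 := congrFun (congrFun (prolateMatrix_mul_self h hW) (Fin.castAdd P i)) (Fin.castAdd P j)
  rw [mul_apply, Fin.sum_univ_add] at h1
  have hcast : ∀ i : Fin N, Fin.castLE hle i = Fin.castAdd P i := fun i => rfl
  rw [Matrix.add_apply, mul_apply, mul_apply]
  simp only [leadingProlate, offBlock, submatrix_apply, conjTranspose_apply, hcast]
  rw [← h1]
  congr 1
  refine sum_congr rfl fun k _ => ?_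
  rw [(prolateMatrix_isHermitian (N + P) W).apply]

theorem sum_eigenvalues_leadingProlate (N M : ℕ) (h : N ≤ M) (W : ℝ) :
    ∑ i, (leadingProlate_isHermitian N M h W).eigenvalues i = 2 * (N * W) := by
  have ht := (leadingProlate_isHermitian N M h W).trace_eq_sum_eigenvalues
  have ht2 : (leadingProlate N M h W).trace = ((2 * (N * W) : ℝ) : ℂ) := by
    simp only [trace, diag_apply, leadingProlate, submatrix_apply, prolateMatrix, Matrix.of_apply,
      if_true, sum_const, card_univ, Fintype.card_fin, nsmul_eq_mul]
    push_cast
    ring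
  rw [ht2] at ht
  apply Complex.ofReal_injective
  rw [ht]
  simp

/-! ### The off-diagonal block: low rank and Frobenius norm -/

theorem abs_sin_nat_mul_le (n : ℕ) (x : ℝ) : |Real.sin (n * x)| ≤ n * |Real.sin x| := by
  induction n with
  | zero => simp
  | succ n ih =>
    have e : ((n + 1 : ℕ) : ℝ) * x = n * x + x := by push_cast; ring
    rw [e, Real.sin_add]
    calc |Real.sin (n * x) * Real.cos x + Real.cos (n * x) * Real.sin x|
        ≤ |Real.sin (n * x)| * |Real.cos x| + |Real.cos (n * x)| * |Real.sin x| := by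
          rw [← abs_mul, ← abs_mul]; exact abs_add_le _ _
      _ ≤ |Real.sin (n * x)| * 1 + 1 * |Real.sin x| := by
          gcongr
          · exact Real.abs_cos_le_one _
          · exact Real.abs_cos_le_one _
      _ ≤ _ := by push_cast; linarith

theorem sin_le_sin_of_le_of_le_pi_sub {h B : ℝ} (h0 : 0 ≤ h) (hB : h ≤ B)
    (hB' : B ≤ Real.pi - h) : Real.sin h ≤ Real.sin B := by
  rcases le_total B (Real.pi / 2) with hc | hc
  · exact Real.sin_le_sin_of_le_of_le_pi_div_two (by linarith [Real.pi_pos]) hc hB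
  · rw [← Real.sin_pi_sub B]
    exact Real.sin_le_sin_of_le_of_le_pi_div_two (by linarith [Real.pi_pos]) (by linarith)
      (by linarith)

/-- Shifting an angle `B ∈ [h, π - h]` by `2 N h` multiplies its sine by at most `2 N + 1`. -/
theorem abs_sin_add_le {N : ℕ} {h B : ℝ} (h0 : 0 < h) (hB : h ≤ B) (hB' : B ≤ Real.pi - h) :
    |Real.sin (2 * N * h + B)| ≤ (2 * N + 1) * Real.sin B ∧
      |Real.sin (2 * N * h - B)| ≤ (2 * N + 1) * Real.sin B := by
  have h1 := sin_le_sin_of_le_of_le_pi_sub h0.le hB hB'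
  have hs : 0 ≤ Real.sin h := Real.sin_nonneg_of_nonneg_of_le_pi h0.le (by linarith)
  have h2 := abs_sin_nat_mul_le (2 * N) h
  rw [abs_of_nonneg hs] at h2
  push_cast at h2
  have h3 : |Real.sin (2 * N * h)| * |Real.cos B| + |Real.cos (2 * N * h)| * |Real.sin B| ≤
      (2 * N + 1) * Real.sin B := by
    rw [abs_of_nonneg (hs.trans h1)]
    have hN : (0 : ℝ) ≤ 2 * N := by positivity
    calc _ ≤ |Real.sin (2 * N * h)| * 1 + 1 * Real.sin B := by
          gcongr
          · exact Real.abs_cos_le_one _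
          · exact hs.trans h1
          · exact Real.abs_cos_le_one _
      _ ≤ _ := by nlinarith
  constructor
  · rw [Real.sin_add]
    refine (abs_add_le _ _).trans ?_
    rw [abs_mul, abs_mul]; exact h3
  · rw [Real.sin_sub]
    refine (abs_sub _ _).trans ?_
    rw [abs_mul, abs_mul]; exact h3

theorem offBlock_apply (N P : ℕ) (W : ℝ) (i : Fin P) (j : Fin N) :
    offBlock N P W i j = ((Real.sin (2 * Real.pi * W * ((N + i : ℝ) - j)) /
      ((N + P) * Real.sin (((N + i : ℝ) - j) * Real.pi / (N + P))) : ℝ) : ℂ) := by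
  have hne : Fin.natAdd N i ≠ Fin.castAdd P j := by
    intro h
    have h1 := congrArg Fin.val h
    have := j.2
    simp at h1
    omega
  rw [offBlock, submatrix_apply, prolateMatrix, Matrix.of_apply, if_neg hne]
  simp

/-- The off-diagonal block is Cauchy-like: with `h = π / (2 (N + P))`, its entries are separable
expressions of rank two divided by `a j b' i + b j a' i`. -/
theorem offBlock_eq_cauchy {N P : ℕ} (hN : 0 < N) (hP : 0 < P) (W : ℝ) {h : ℝ}
    (hh : h = Real.pi / (2 * (N + P))) :
    ∃ (ξ : Fin P → Fin 2 → ℂ) (η : Fin N → Fin 2 → ℂ), ∀ i j,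
      offBlock N P W i j = (∑ s, ξ i s * η j s) /
        ((Real.sin ((2 * j + 1) * h) * Real.sin ((2 * i + 1) * h) +
          Real.sin (2 * N * h - (2 * j + 1) * h) * Real.sin (2 * N * h + (2 * i + 1) * h) : ℝ) :
            ℂ) := by
  have hNR : (0 : ℝ) < N := by exact_mod_cast hN
  have hPR : (0 : ℝ) < P := by exact_mod_cast hP
  have hG : Real.sin (2 * N * h) ≠ 0 := by
    refine (Real.sin_pos_of_pos_of_lt_pi ?_ ?_).ne'
    · rw [hh]; have := Real.pi_pos; positivity
    · have e : 2 * N * h = Real.pi * (N / (N + P)) := by rw [hh]; field_simp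
      have : (N / (N + P) : ℝ) < 1 := by rw [div_lt_one (by positivity)]; linarith
      rw [e]; nlinarith [Real.pi_pos]
  let ω : ℝ := 2 * Real.pi * W
  let c : ℝ := Real.sin (2 * N * h) / (N + P)
  refine ⟨fun i => ![((c * Real.sin (ω * (N + i)) : ℝ) : ℂ), ((-c * Real.cos (ω * (N + i)) : ℝ) : ℂ)],
    fun j => ![((Real.cos (ω * j) : ℝ) : ℂ), ((Real.sin (ω * j) : ℝ) : ℂ)], fun i j => ?_⟩
  rw [offBlock_apply, Fin.sum_univ_two]
  simp only [Matrix.cons_val_zero, Matrix.cons_val_one]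
  rw [← Complex.ofReal_mul, ← Complex.ofReal_mul, ← Complex.ofReal_add, ← Complex.ofReal_div]
  congr 1
  have e1 : Real.sin ((2 * j + 1) * h) * Real.sin ((2 * i + 1) * h) +
      Real.sin (2 * N * h - (2 * j + 1) * h) * Real.sin (2 * N * h + (2 * i + 1) * h) =
      Real.sin (2 * N * h) * Real.sin (((N + i : ℝ) - j) * Real.pi / (N + P)) := by
    have e2 : ((N + i : ℝ) - j) * Real.pi / (N + P) =
        (2 * N * h + (2 * i + 1) * h) - (2 * j + 1) * h := by rw [hh]; field_simp; ring
    have e3 : (2 * i + 1) * h = (2 * N * h + (2 * i + 1) * h) - 2 * N * h := by ring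
    rw [e2]
    generalize 2 * N * h + (2 * i + 1) * h = y at e3 ⊢
    rw [e3, Real.sin_sub, Real.sin_sub, Real.sin_sub]
    ring
  have e4 : c * Real.sin (ω * (N + i)) * Real.cos (ω * j) +
      -c * Real.cos (ω * (N + i)) * Real.sin (ω * j) =
      c * Real.sin (2 * Real.pi * W * ((N + i : ℝ) - j)) := by
    rw [mul_sub, Real.sin_sub]; ring
  rw [e1, e4]
  have hNP : (0 : ℝ) < N + P := by positivity
  simp only [c]
  rw [div_mul_eq_mul_div, div_div, mul_left_comm, mul_div_mul_left _ _ hG]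

/-- The energy bound for the off-diagonal block, from its Cauchy structure with `q = 2 N + 1`. -/
theorem exists_linearMap_offBlock_energy_le {N P : ℕ} (hN : 0 < N) (hP : 0 < P) (W : ℝ)
    (hquarter : ∀ v, ∑ i, ‖(offBlock N P W *ᵥ v) i‖ ^ 2 ≤ 1 / 4 * ∑ j, ‖v j‖ ^ 2)
    (μ J : ℕ) (hJ : (2 * N + 1 : ℝ) ^ 2 < 25 ^ (J - 1)) :
    ∃ Φ : (Fin N → ℂ) →ₗ[ℂ] (Fin (μ * J) × Fin 2 → ℂ), ∀ v, Φ v = 0 →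
      ∑ i, ‖(offBlock N P W *ᵥ v) i‖ ^ 2 ≤ 1 / 4 * ((4 / 9) ^ μ) ^ 4 * ∑ j, ‖v j‖ ^ 2 := by
  have hNR : (0 : ℝ) < N := by exact_mod_cast hN
  have hPR : (0 : ℝ) < P := by exact_mod_cast hP
  obtain ⟨h, hh⟩ : ∃ h : ℝ, h = Real.pi / (2 * (N + P)) := ⟨_, rfl⟩
  have h0 : 0 < h := by rw [hh]; have := Real.pi_pos; positivity
  have hpi : Real.pi = 2 * (N + P) * h := by rw [hh]; field_simp
  obtain ⟨ξ, η, hC⟩ := offBlock_eq_cauchy hN hP W hh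
  have hj : ∀ j : Fin N, (0 : ℝ) ≤ j ∧ (j : ℝ) + 1 ≤ N := fun j =>
    ⟨by positivity, by exact_mod_cast j.2⟩
  have hi : ∀ i : Fin P, (0 : ℝ) ≤ i ∧ (i : ℝ) + 1 ≤ P := fun i =>
    ⟨by positivity, by exact_mod_cast i.2⟩
  have hA : ∀ j : Fin N, h ≤ (2 * j + 1) * h ∧ (2 * j + 1) * h ≤ Real.pi - h := fun j => by
    obtain ⟨u, v⟩ := hj j; rw [hpi]; constructor <;> nlinarith
  have hB : ∀ j : Fin N, h ≤ 2 * N * h - (2 * j + 1) * h ∧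
      2 * N * h - (2 * j + 1) * h ≤ Real.pi - h := fun j => by
    obtain ⟨u, v⟩ := hj j; rw [hpi]; constructor <;> nlinarith
  have hA' : ∀ i : Fin P, h ≤ 2 * N * h + (2 * i + 1) * h ∧
      2 * N * h + (2 * i + 1) * h ≤ Real.pi - h := fun i => by
    obtain ⟨u, v⟩ := hi i; rw [hpi]; constructor <;> nlinarith
  have hB' : ∀ i : Fin P, h ≤ (2 * i + 1) * h ∧ (2 * i + 1) * h ≤ Real.pi - h := fun i => by
    obtain ⟨u, v⟩ := hi i; rw [hpi]; constructor <;> nlinarith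
  have pos : ∀ B, h ≤ B ∧ B ≤ Real.pi - h → 0 < Real.sin B := fun B hb =>
    Real.sin_pos_of_pos_of_lt_pi (by linarith [hb.1]) (by linarith [hb.2])
  refine exists_linearMap_energy_le (fun j => pos _ (hA j)) (fun j => pos _ (hB j))
    (fun i => pos _ (hA' i)) (fun i => pos _ (hB' i)) hC hquarter (q := 2 * N + 1)
    (by positivity) ?_ ?_ ?_ ?_ μ J hJ
  · intro j
    have := (le_abs_self _).trans (abs_sin_add_le (N := N) h0 (hB j).1 (hB j).2).2
    rwa [sub_sub_cancel] at this
  · intro j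
    exact (le_abs_self _).trans (abs_sin_add_le (N := N) h0 (hA j).1 (hA j).2).2
  · intro i
    exact (le_abs_self _).trans (abs_sin_add_le (N := N) h0 (hB' i).1 (hB' i).2).1
  · intro i
    have := (neg_le_abs _).trans (abs_sin_add_le (N := N) h0 (hA' i).1 (hA' i).2).2
    rwa [← Real.sin_neg, neg_sub, add_sub_cancel_left] at this

theorem cot_le_inv {x : ℝ} (h0 : 0 < x) (h1 : x < Real.pi) : Real.cot x ≤ x⁻¹ := by
  have hs := Real.sin_pos_of_pos_of_lt_pi h0 h1
  rw [Real.cot_eq_cos_div_sin, div_le_iff₀ hs, ← div_eq_inv_mul, le_div_iff₀ h0]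
  rcases lt_or_ge x (Real.pi / 2) with hc | hc
  · have hcos := Real.cos_pos_of_mem_Ioo ⟨by linarith, hc⟩
    have := (Real.lt_tan h0 hc).le
    rw [Real.tan_eq_sin_div_cos, le_div_iff₀ hcos] at this
    linarith
  · have := Real.cos_nonpos_of_pi_div_two_le_of_le hc (by linarith)
    nlinarith

/-- Telescoping majorant of `1 / sin²`. -/
theorem inv_sin_sq_le {x h : ℝ} (h0 : 0 < h) (h1 : h < x) (h2 : x + h < Real.pi) :
    (Real.sin x ^ 2)⁻¹ ≤ (Real.cot (x - h) - Real.cot (x + h)) / Real.sin (2 * h) := by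
  have hm := Real.sin_pos_of_pos_of_lt_pi (by linarith : 0 < x - h) (by linarith)
  have hp := Real.sin_pos_of_pos_of_lt_pi (by linarith : 0 < x + h) h2
  have hd := Real.sin_pos_of_pos_of_lt_pi (by linarith : 0 < 2 * h) (by linarith)
  have e : Real.cot (x - h) - Real.cot (x + h) =
      Real.sin (2 * h) / (Real.sin (x - h) * Real.sin (x + h)) := by
    rw [Real.cot_eq_cos_div_sin, Real.cot_eq_cos_div_sin, div_sub_div _ _ hm.ne' hp.ne']
    congr 1
    rw [show 2 * h = (x + h) - (x - h) by ring, Real.sin_sub (x + h) (x - h)]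
    ring
  rw [e, div_div, mul_comm _ (Real.sin (2 * h)), ← div_div, div_self hd.ne', one_div]
  refine inv_anti₀ (mul_pos hm hp) ?_
  have : Real.sin (x - h) * Real.sin (x + h) = Real.sin x ^ 2 - Real.sin h ^ 2 := by
    rw [Real.sin_add, Real.sin_sub]
    linear_combination (Real.sin x ^ 2) * Real.cos_sq' h - (Real.sin h ^ 2) * Real.cos_sq' x
  rw [this]
  nlinarith [sq_nonneg (Real.sin h)]

theorem sum_inv_add_half_le (N : ℕ) :
    ∑ j ∈ range N, ((j : ℝ) + 1 / 2)⁻¹ ≤ 3 + Real.log N := by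
  have h : ∀ n : ℕ, ∑ j ∈ range (n + 1), ((j : ℝ) + 1 / 2)⁻¹ ≤ 2 + (harmonic n : ℝ) := by
    intro n
    induction n with
    | zero => norm_num
    | succ n ih =>
      rw [sum_range_succ, harmonic_succ]
      push_cast
      have : ((n : ℝ) + 1 + 1 / 2)⁻¹ ≤ ((n : ℝ) + 1)⁻¹ :=
        inv_anti₀ (by positivity) (by linarith)
      linarith
  have h2 := harmonic_le_one_add_log N
  have h3 : ∑ j ∈ range N, ((j : ℝ) + 1 / 2)⁻¹ ≤ ∑ j ∈ range (N + 1), ((j : ℝ) + 1 / 2)⁻¹ :=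
    sum_le_sum_of_subset_of_nonneg (range_mono (Nat.le_succ N)) fun _ _ _ => by positivity
  linarith [h N]

/-- The sine in the numerator is bounded by one, and the rest telescopes along columns. -/
theorem norm_sq_offBlock_le {N P : ℕ} (W : ℝ) {h : ℝ}
    (hh : h = Real.pi / (2 * (N + P))) (i : Fin P) (j : Fin N) :
    ‖offBlock N P W i j‖ ^ 2 ≤ ((N + P : ℝ) ^ 2 * Real.sin (2 * h))⁻¹ *
      (Real.cot ((2 * (N + i - j) - 1) * h) - Real.cot ((2 * (N + (i + 1 : ℕ) - j) - 1) * h)) := by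
  have hj : (0 : ℝ) ≤ j ∧ (j : ℝ) + 1 ≤ N := ⟨by positivity, by exact_mod_cast j.2⟩
  have hi : (0 : ℝ) ≤ i ∧ (i : ℝ) + 1 ≤ P := ⟨by positivity, by exact_mod_cast i.2⟩
  have hNP : (0 : ℝ) < N + P := by linarith [hj.1, hj.2, hi.1, hi.2]
  have h0 : 0 < h := by rw [hh]; have := Real.pi_pos; positivity
  have hpi : Real.pi = 2 * (N + P) * h := by rw [hh]; field_simp
  have hx : ((N + i : ℝ) - j) * Real.pi / (N + P) = 2 * (N + i - j) * h := by
    rw [hpi]; field_simp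
  have key := inv_sin_sq_le (x := 2 * (N + i - j) * h) h0
    (by nlinarith [hj.1, hj.2, hi.1, hi.2]) (by rw [hpi]; nlinarith [hj.1, hj.2, hi.1, hi.2])
  have e1 : 2 * (N + i - j) * h - h = (2 * (N + i - j) - 1) * h := by ring
  have e2 : 2 * (N + i - j) * h + h = (2 * (N + (i + 1 : ℕ) - j) - 1) * h := by push_cast; ring
  rw [e1, e2] at key
  rw [offBlock_apply, Complex.norm_real, Real.norm_eq_abs, sq_abs, hx, div_pow, mul_pow]
  have hs : Real.sin (2 * Real.pi * W * ((N + i : ℝ) - j)) ^ 2 ≤ 1 := Real.sin_sq_le_one _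
  calc _ ≤ 1 / ((N + P : ℝ) ^ 2 * Real.sin (2 * (N + i - j) * h) ^ 2) :=
        div_le_div_of_nonneg_right hs (by positivity)
    _ = ((N + P : ℝ) ^ 2)⁻¹ * (Real.sin (2 * (N + i - j) * h) ^ 2)⁻¹ := by
        rw [one_div, mul_inv]
    _ ≤ ((N + P : ℝ) ^ 2)⁻¹ * _ := mul_le_mul_of_nonneg_left key (by positivity)
    _ = _ := by rw [mul_inv, div_eq_mul_inv]; ring

theorem frobenius_offBlock_le_sum {N P : ℕ} (hN : 0 < N) (hP : 0 < P) (W : ℝ) :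
    ∑ i, ∑ j, ‖offBlock N P W i j‖ ^ 2 ≤
      2 / (Real.pi * ((N + P) * Real.sin (Real.pi / (N + P)))) * (3 + Real.log N) := by
  have hNR : (1 : ℝ) ≤ N := by exact_mod_cast hN
  have hPR : (1 : ℝ) ≤ P := by exact_mod_cast hP
  obtain ⟨h, hh⟩ : ∃ h : ℝ, h = Real.pi / (2 * (N + P)) := ⟨_, rfl⟩
  have h0 : 0 < h := by rw [hh]; have := Real.pi_pos; positivity
  have hpi : Real.pi = 2 * (N + P) * h := by rw [hh]; field_simp
  have h2 : Real.pi / (N + P) = 2 * h := by rw [hh]; field_simp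
  have hs : 0 < Real.sin (2 * h) :=
    Real.sin_pos_of_pos_of_lt_pi (by linarith) (by rw [hpi]; nlinarith)
  have hinner : ∀ j : Fin N, ∑ i, ‖offBlock N P W i j‖ ^ 2 ≤
      ((N + P : ℝ) ^ 2 * Real.sin (2 * h))⁻¹ *
        (Real.cot ((2 * (N - 1 - j) + 1) * h) + Real.cot ((2 * j + 1) * h)) := by
    intro j
    refine (sum_le_sum fun i _ => norm_sq_offBlock_le W hh i j).trans (le_of_eq ?_)
    rw [← mul_sum, Fin.sum_univ_eq_sum_range (fun i : ℕ => Real.cot ((2 * (N + i - j) - 1) * h) -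
      Real.cot ((2 * (N + (i + 1 : ℕ) - j) - 1) * h)) P,
      sum_range_sub' (fun i : ℕ => Real.cot ((2 * (N + i - j) - 1) * h))]
    have e : (2 * (N + P - j) - 1) * h = Real.pi - (2 * j + 1) * h := by rw [hpi]; ring
    rw [e, Real.cot_eq_cos_div_sin (Real.pi - _), Real.cos_pi_sub, Real.sin_pi_sub, neg_div,
      ← Real.cot_eq_cos_div_sin, sub_neg_eq_add]
    congr 3
    push_cast
    ring
  -- the reflection `j ↦ N - 1 - j` exchanges the two ends of the block
  have hsum : ∑ j : Fin N, (Real.cot ((2 * (N - 1 - j) + 1) * h) + Real.cot ((2 * j + 1) * h)) =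
      2 * ∑ j ∈ range N, Real.cot ((2 * j + 1) * h) := by
    rw [Fin.sum_univ_eq_sum_range (fun j : ℕ => Real.cot ((2 * ((N : ℝ) - 1 - j) + 1) * h) +
      Real.cot ((2 * j + 1) * h)) N, sum_add_distrib, two_mul]
    congr 1
    rw [← sum_range_reflect]
    refine sum_congr rfl fun j hj => ?_
    have hjN : j < N := mem_range.1 hj
    rw [Nat.cast_sub (by omega), Nat.cast_sub (by omega)]
    push_cast
    congr 2
    ring
  have hcot : ∑ j ∈ range N, Real.cot ((2 * j + 1) * h) ≤ (2 * h)⁻¹ * (3 + Real.log N) := by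
    refine le_trans ?_ (mul_le_mul_of_nonneg_left (sum_inv_add_half_le N) (by positivity))
    rw [mul_sum]
    refine sum_le_sum fun j hj => ?_
    have hjN : (j : ℝ) + 1 ≤ N := by exact_mod_cast mem_range.1 hj
    have hj0 : (0 : ℝ) ≤ j := by positivity
    refine (cot_le_inv (by positivity) (by rw [hpi]; nlinarith)).trans (le_of_eq ?_)
    rw [← mul_inv]; congr 1; ring
  rw [sum_comm]
  refine (sum_le_sum fun j _ => hinner j).trans ?_
  rw [← mul_sum, hsum, h2]
  calc _ ≤ ((N + P : ℝ) ^ 2 * Real.sin (2 * h))⁻¹ * (2 * ((2 * h)⁻¹ * (3 + Real.log N))) := by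
        gcongr
    _ = _ := by rw [hpi]; field_simp

/-- The Frobenius energy of the off-diagonal block grows like `(2 / π²) log N`. -/
theorem frobenius_offBlock_le {N P : ℕ} (hN : 0 < N) (hP : 0 < P) (W : ℝ) :
    ∑ i, ∑ j, ‖offBlock N P W i j‖ ^ 2 ≤ 2 / Real.pi ^ 2 * Real.log N + 2 := by
  refine (frobenius_offBlock_le_sum hN hP W).trans ?_
  have hNR : (1 : ℝ) ≤ N := by exact_mod_cast hN
  have hPR : (1 : ℝ) ≤ P := by exact_mod_cast hP
  set L := Real.log N with hL
  have hL0 : 0 ≤ L := Real.log_nonneg hNR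
  set M : ℝ := N + P with hM
  have hM2 : 2 ≤ M := by linarith
  have hLM : L ≤ M := by
    have := Real.log_le_sub_one_of_pos (by linarith : (0 : ℝ) < N)
    linarith
  have p3 := Real.pi_gt_d2
  have p4 := Real.pi_lt_d2
  have hpos := Real.pi_pos
  have hpsq : Real.pi ^ 2 < 9.93 := by nlinarith
  -- `s` is the relative error of `sin y ≈ y` at `y = π / M`
  set s : ℝ := Real.pi ^ 2 / (6 * M ^ 2) with hs
  have hs0 : 0 < s := by positivity
  have hs1 : s ≤ 0.414 := by
    rw [hs, div_le_iff₀ (by positivity)]; nlinarith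
  have hsL : s * L ≤ 0.83 := by
    have h1 : s * L ≤ s * M := mul_le_mul_of_nonneg_left hLM hs0.le
    have h2 : s * M = Real.pi ^ 2 / (6 * M) := by rw [hs]; field_simp
    have h3 : Real.pi ^ 2 / (6 * M) ≤ 0.83 := by rw [div_le_iff₀ (by positivity)]; nlinarith
    linarith
  have hsin : Real.pi * (1 - s) ≤ M * Real.sin (Real.pi / M) := by
    have h1 := (Real.sin_gt_sub_cube (x := Real.pi / M) (by positivity)).le
    have h2 : Real.pi * (1 - s) = M * (Real.pi / M - (Real.pi / M) ^ 3 / 6) := by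
      rw [hs]; field_simp
    rw [h2]
    exact mul_le_mul_of_nonneg_left h1 (by linarith)
  have hinv : 1 ≤ (1 + 1.75 * s) * (1 - s) := by nlinarith
  have h1 : 2 / (Real.pi * (M * Real.sin (Real.pi / M))) ≤ 2 / Real.pi ^ 2 * (1 + 1.75 * s) := by
    have hd : 0 < Real.pi * (1 - s) := by nlinarith
    rw [div_mul_eq_mul_div, div_le_div_iff₀ (mul_pos hpos (hd.trans_le hsin)) (by positivity)]
    have : Real.pi ^ 2 ≤ (1 + 1.75 * s) * (Real.pi * (Real.pi * (1 - s))) := by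
      nlinarith [mul_le_mul_of_nonneg_left hinv (sq_nonneg Real.pi)]
    have h3 : (1 + 1.75 * s) * (Real.pi * (Real.pi * (1 - s))) ≤
        (1 + 1.75 * s) * (Real.pi * (M * Real.sin (Real.pi / M))) := by gcongr
    linarith
  calc _ ≤ 2 / Real.pi ^ 2 * (1 + 1.75 * s) * (3 + L) := by gcongr
    _ = 2 / Real.pi ^ 2 * L + 2 / Real.pi ^ 2 * (3 + 5.25 * s + 1.75 * (s * L)) := by ring
    _ ≤ _ := by
      have : 2 / Real.pi ^ 2 * (3 + 5.25 * s + 1.75 * (s * L)) ≤ 2 := by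
        rw [div_mul_eq_mul_div, div_le_iff₀ (by positivity)]
        nlinarith
      linarith

/-! ### Numerical bounds and the eigenvalue distribution -/

/-- At most `2 μ J` eigenvalues of the leading block lie in the transition band. -/
theorem card_transition_le {N P K : ℕ} {W : ℝ} (hN : 0 < N) (hP : 0 < P) (h : 2 * K + 1 ≤ N + P)
    (hW : W = (2 * (K : ℝ) + 1) / (2 * ((N + P : ℕ) : ℝ))) (hle : N ≤ N + P) {ε : ℝ}
    (h0 : 0 < ε) (h1 : ε < 1 / 2) {μ J : ℕ} (hJ : (2 * N + 1 : ℝ) ^ 2 < 25 ^ (J - 1))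
    (hμ : ((2 / 3 : ℝ) ^ 8) ^ μ ≤ 2 * ε) :
    (univ.filter fun i => ε < (leadingProlate_isHermitian N (N + P) hle W).eigenvalues i ∧
      (leadingProlate_isHermitian N (N + P) hle W).eigenvalues i < 1 - ε).card ≤ 2 * (μ * J) := by
  have hA := leadingProlate_isHermitian N (N + P) hle W
  have hC := leadingProlate_eq h hW hle
  obtain ⟨Φ, hΦ⟩ := exists_linearMap_offBlock_energy_le hN hP W
    (sum_norm_sq_mulVec_le_quarter hA _ hC) μ J hJ
  refine (card_eigenvalues_le hA _ hC Φ hΦ _ fun i hi => ?_).trans (by simp [mul_comm])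
  obtain ⟨ha, hb⟩ := (mem_filter.1 hi).2
  -- `(2 / 3) ^ (8 μ) / 4 ≤ ε / 2 < λ (1 - λ)`
  have e : (((4 / 9 : ℝ)) ^ μ) ^ 4 = ((2 / 3 : ℝ) ^ 8) ^ μ := by
    rw [← pow_mul, mul_comm, pow_mul]; norm_num
  rw [e]
  nlinarith [mul_pos (sub_pos.2 ha) (sub_pos.2 hb)]

/-- The number `J` of nodes in ratio `25` that cover `[1 / q, q]` for `q = 2 N + 1`. -/
theorem exists_node_count {N : ℕ} (hN : 0 < N) :
    ∃ J : ℕ, (2 * N + 1 : ℝ) ^ 2 < 25 ^ (J - 1) ∧ (J : ℝ) ≤ 0.6214 * Real.log N + 2.69 := by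
  have hNR : (1 : ℝ) ≤ N := by exact_mod_cast hN
  have l3 := Real.log_three_lt_d9
  have l5 := Real.log_five_gt_d9
  have l5p : 0 < Real.log 5 := by linarith
  have hq : 0 ≤ Real.log (2 * N + 1) := Real.log_nonneg (by linarith)
  have hL : 0 ≤ Real.log N := Real.log_nonneg hNR
  refine ⟨⌊Real.log (2 * N + 1) / Real.log 5⌋₊ + 2, ?_, ?_⟩
  · have h1 := Nat.lt_floor_add_one (Real.log (2 * N + 1) / Real.log 5)
    rw [div_lt_iff₀ l5p] at h1
    have e : (25 : ℝ) ^ (⌊Real.log (2 * N + 1) / Real.log 5⌋₊ + 2 - 1) =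
        (5 ^ (⌊Real.log (2 * N + 1) / Real.log 5⌋₊ + 1)) ^ 2 := by
      rw [← pow_mul, mul_comm _ 2, pow_mul, show (5 : ℝ) ^ 2 = 25 by norm_num]
      rfl
    rw [e]
    refine pow_lt_pow_left₀ ?_ (by positivity) two_ne_zero
    rw [← Real.log_lt_log_iff (by positivity) (by positivity), Real.log_pow]
    push_cast
    exact h1
  · have h1 := Nat.floor_le (div_nonneg hq l5p.le)
    have h2 : Real.log (2 * N + 1) ≤ Real.log 3 + Real.log N := by
      rw [← Real.log_mul (by norm_num) (by positivity)]
      exact Real.log_le_log (by positivity) (by linarith)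
    have h3 : Real.log (2 * N + 1) / Real.log 5 ≤ 0.6214 * Real.log N + 0.69 := by
      rw [div_le_iff₀ l5p]
      nlinarith
    push_cast
    linarith

theorem log_three_halves_gt : 0.405464 < Real.log (3 / 2) := by
  rw [Real.log_div (by norm_num) (by norm_num)]
  linarith [Real.log_three_gt_d9, Real.log_two_lt_d9]

/-- The multiplicity `μ` of the nodes: it is `1` unless `ε` is small, and then it is
about `log (1 / (2 ε)) / (8 log (3 / 2))`. -/
theorem exists_multiplicity {ε : ℝ} (h0 : 0 < ε) :
    ∃ μ : ℕ, ((2 / 3 : ℝ) ^ 8) ^ μ ≤ 2 * ε ∧ ((μ : ℝ) ≤ 1 ∨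
      ((μ : ℝ) ≤ 1 + Real.log (1 / (2 * ε)) / 3.2437 ∧ 3.2437 ≤ Real.log (1 / (2 * ε)) ∧
        ε ≤ 0.0196)) := by
  have hl := log_three_halves_gt
  set x := Real.log (1 / (2 * ε)) with hx
  set d := 8 * Real.log (3 / 2) with hd
  have hd1 : 3.2437 < d := by rw [hd]; linarith
  have hd0 : 0 < d := by linarith
  have hlog : Real.log (2 * ε) = -x := by rw [hx, one_div, Real.log_inv, neg_neg]
  have hl23 : Real.log ((2 / 3 : ℝ) ^ 8) = -d := by
    rw [Real.log_pow, hd, show (2 / 3 : ℝ) = (3 / 2)⁻¹ by norm_num, Real.log_inv]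
    push_cast; ring
  refine ⟨⌈x / d⌉₊, ?_, ?_⟩
  · rw [← Real.log_le_log_iff (by positivity) (by positivity), Real.log_pow, hl23, hlog]
    have := Nat.le_ceil (x / d)
    rw [div_le_iff₀ hd0] at this
    linarith
  · rcases le_or_gt x d with hc | hc
    · left
      have : ⌈x / d⌉₊ ≤ 1 := Nat.ceil_le.2 (by rw [Nat.cast_one, div_le_one hd0]; exact hc)
      exact_mod_cast this
    · right
      have hx0 : 0 < x := hd0.trans hc
      refine ⟨?_, by linarith, ?_⟩
      · have h1 := Nat.ceil_lt_add_one (div_nonneg hx0.le hd0.le)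
        have h2 : x / d ≤ x / 3.2437 := div_le_div_of_nonneg_left hx0.le (by norm_num) hd1.le
        linarith
      · have : Real.log (2 * ε) ≤ Real.log ((2 / 3 : ℝ) ^ 8) := by rw [hlog, hl23]; linarith
        have := (Real.log_le_log_iff (by positivity) (by positivity)).1 this
        norm_num at this ⊢
        linarith

/-- The numerical comparison between the transition count and the width: the coefficient of `L`
carries the balance between location error and number of nodes, the constants are generous. -/
theorem numerical_width_bound {L x ε τ t μ : ℝ} (hL : 0 ≤ L) (h0 : 0 < ε) (h1 : ε < 1 / 2)
    (hx : 1 - 2 * ε ≤ x) (hτ : τ ≤ 0.2027 * L + 2)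
    (ht : t ≤ 2 * (μ * (0.6214 * L + 2.69)))
    (hμ : μ ≤ 1 ∨ (μ ≤ 1 + x / 3.2437 ∧ 3.2437 ≤ x ∧ ε ≤ 0.0196)) :
    τ / (1 - ε) + (1 - 2 * ε) * t + 2 ≤ (0.40528 * (L + 2.0794) + 6) * (x + 3.4657) := by
  have he : 0 < 1 - ε := by linarith
  have hx0 : 0 < x := by linarith
  have hB : 0 < 0.6214 * L + 2.69 := by linarith
  have hxL : 0 ≤ x * L := by positivity
  rcases hμ with hμ | ⟨hμ, hx1, he1⟩
  · have a1 : τ / (1 - ε) ≤ 2 * (0.2027 * L + 2) := by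
      rw [div_le_iff₀ he]; nlinarith
    have a2 : t ≤ 2 * (0.6214 * L + 2.69) := by nlinarith
    have a3 : (1 - 2 * ε) * t ≤ (1 - 2 * ε) * (2 * (0.6214 * L + 2.69)) :=
      mul_le_mul_of_nonneg_left a2 (by linarith)
    -- near `ε = 1 / 2` the coefficient of `L` is small enough only thanks to `1 - 2 ε ≤ x`
    rcases le_total x 1 with hc | hc
    · have a4 : (1 - 2 * ε) * (2 * (0.6214 * L + 2.69)) ≤ x * (2 * (0.6214 * L + 2.69)) :=
        mul_le_mul_of_nonneg_right hx (by linarith)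
      have a5 : x * L ≤ L := by nlinarith
      nlinarith
    · have a4 : (1 - 2 * ε) * (2 * (0.6214 * L + 2.69)) ≤ 1 * (2 * (0.6214 * L + 2.69)) :=
        mul_le_mul_of_nonneg_right (by linarith) (by linarith)
      have a5 : L ≤ x * L := by nlinarith
      nlinarith
  · have a1 : τ / (1 - ε) ≤ 1.02 * (0.2027 * L + 2) := by
      rw [div_le_iff₀ he]; nlinarith
    have a2 : t ≤ 2 * ((1 + x / 3.2437) * (0.6214 * L + 2.69)) := by nlinarith
    have a2' : 0 ≤ 2 * ((1 + x / 3.2437) * (0.6214 * L + 2.69)) := by positivity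
    have a3 : (1 - 2 * ε) * t ≤ 2 * ((1 + x / 3.2437) * (0.6214 * L + 2.69)) := by nlinarith
    have a4 : x / 3.2437 ≤ 0.3083 * x := by
      rw [div_le_iff₀ (by norm_num)]; linarith
    have a5 : 2 * ((1 + x / 3.2437) * (0.6214 * L + 2.69)) ≤
        2 * ((1 + 0.3083 * x) * (0.6214 * L + 2.69)) := by gcongr
    have a6 : 3.2437 * L ≤ x * L := mul_le_mul_of_nonneg_right hx1 hL
    nlinarith

/-- The transition width from below, with `log (16 / ε) = log (1 / (2 ε)) + 5 log 2` and the second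
summand, which is nonnegative, dropped. -/
theorem le_transitionWidth {N M : ℕ} (hN : 0 < N) {ε : ℝ} (h0 : 0 < ε) (h1 : ε < 1 / 2) :
    (0.40528 * (Real.log N + 2.0794) + 6) * (Real.log (1 / (2 * ε)) + 3.4657) ≤
      transitionWidth N M ε := by
  have hNR : (1 : ℝ) ≤ N := by exact_mod_cast hN
  have hL : 0 ≤ Real.log N := Real.log_nonneg hNR
  have l2 := Real.log_two_gt_d9
  have e1 : Real.log (8 * N) = Real.log N + 3 * Real.log 2 := by
    rw [add_comm, Real.log_mul (by norm_num) (by positivity), show (8 : ℝ) = 2 ^ 3 by norm_num, Real.log_pow]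
    norm_num
  have e2 : Real.log (16 / ε) = Real.log (1 / (2 * ε)) + 5 * Real.log 2 := by
    rw [show (16 : ℝ) / ε = 1 / (2 * ε) * 2 ^ 5 by field_simp; norm_num,
      Real.log_mul (by positivity) (by norm_num), Real.log_pow]
    norm_num
  have hx : 0 ≤ Real.log (1 / (2 * ε)) :=
    Real.log_nonneg (by rw [le_div_iff₀ (by positivity)]; linarith)
  have hpi : 0.40528 ≤ 4 / Real.pi ^ 2 := by
    have := Real.pi_lt_d6
    rw [le_div_iff₀ (by positivity)]
    nlinarith [Real.pi_pos]
  rw [transitionWidth, e1, e2]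
  refine le_add_of_le_of_nonneg ?_ (mul_nonneg zero_le_two (le_max_right _ _))
  gcongr <;> linarith

/-- The error made in locating the transition band through the trace, with room for rounding
`2 N W` to an even integer, is at most the transition width. -/
theorem location_error_add_two_le {N P K : ℕ} {W : ℝ} (hN : 0 < N) (hP : 0 < P)
    (h : 2 * K + 1 ≤ N + P) (hW : W = (2 * (K : ℝ) + 1) / (2 * ((N + P : ℕ) : ℝ)))
    (hle : N ≤ N + P) {ε : ℝ} (h0 : 0 < ε) (h1 : ε < 1 / 2) {l : Fin N → ℝ}
    (hl : l = (leadingProlate_isHermitian N (N + P) hle W).eigenvalues) :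
    (∑ i, l i * (1 - l i)) / (1 - ε) +
      (1 - 2 * ε) * (univ.filter fun i => ε < l i ∧ l i < 1 - ε).card + 2 ≤
        transitionWidth N (N + P) ε := by
  have hNR : (1 : ℝ) ≤ N := by exact_mod_cast hN
  obtain ⟨J, hJ, hJ'⟩ := exists_node_count hN
  obtain ⟨μ, hμ, hμ'⟩ := exists_multiplicity h0
  have ht := card_transition_le hN hP h hW hle h0 h1 hJ hμ
  have hτ := sum_eigenvalues_mul_one_sub (leadingProlate_isHermitian N (N + P) hle W) _
    (leadingProlate_eq h hW hle)
  rw [← hl] at ht hτ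
  refine le_trans ?_ (le_transitionWidth hN h0 h1)
  refine numerical_width_bound (Real.log_nonneg hNR) h0 h1 ?_ ?_ ?_ hμ'
  · have := Real.one_sub_inv_le_log_of_pos (x := 1 / (2 * ε)) (by positivity)
    rwa [one_div, inv_inv, ← one_div] at this
  · rw [hτ]
    refine (frobenius_offBlock_le hN hP W).trans ?_
    have hpi : 2 / Real.pi ^ 2 ≤ 0.2027 := by
      have := Real.pi_gt_d4
      rw [div_le_iff₀ (by positivity)]
      nlinarith
    have := mul_le_mul_of_nonneg_right hpi (Real.log_nonneg hNR)
    linarith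
  · have : (((univ.filter fun i => ε < l i ∧ l i < 1 - ε).card : ℕ) : ℝ) ≤ 2 * (μ * J) := by
      exact_mod_cast ht
    refine this.trans ?_
    gcongr

theorem le_of_card_gt_le {N : ℕ} {l : Fin N → ℝ} (hl : Antitone l) {c : ℝ} {i : Fin N}
    (h : (univ.filter fun j => c < l j).card ≤ i) : l i ≤ c := by
  by_contra! hc
  have hsub : Iic i ⊆ univ.filter fun j => c < l j := fun j hj =>
    mem_filter.2 ⟨mem_univ _, hc.trans_le (hl (mem_Iic.1 hj))⟩
  have := card_le_card hsub
  rw [Fin.card_Iic] at this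
  omega

theorem le_of_lt_card_ge {N : ℕ} {l : Fin N → ℝ} (hl : Antitone l) {c : ℝ} {i : Fin N}
    (h : i < (univ.filter fun j => c ≤ l j).card) : c ≤ l i := by
  by_contra! hc
  have hsub : (univ.filter fun j => c ≤ l j) ⊆ Iio i := fun j hj => by
    rw [mem_Iio]
    by_contra! hij
    exact absurd ((mem_filter.1 hj).2.trans (hl hij)) (not_le.2 hc)
  have := card_le_card hsub
  rw [Fin.card_Iio] at this
  omega

theorem ncard_le_of_between {N : ℕ} {S : Set (Fin N)} {F r : ℤ} (hr : 0 ≤ r)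
    (hS : ∀ i ∈ S, 2 * F - r < (i : ℤ) ∧ (i : ℤ) < 2 * F + r + 1) : (S.ncard : ℤ) ≤ 2 * r := by
  have hinj : Set.InjOn (fun i : Fin N => (i : ℤ)) S := fun a _ b _ hab =>
    Fin.ext (Int.ofNat.inj hab)
  have hle := Set.ncard_le_ncard_of_injOn (t := (Ioo (2 * F - r) (2 * F + r + 1) : Finset ℤ))
    (fun i : Fin N => (i : ℤ)) (fun i hi => by simpa using hS i hi) hinj (Finset.finite_toSet _)
  rw [Set.ncard_coe_finset, Int.card_Ioo] at hle
  omega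

/-- The eigenvalues indexed by rows are a permutation of the ordered ones. -/
theorem exists_equiv_prolateEigenvalue (N M : ℕ) (h : N ≤ M) (W : ℝ) :
    ∃ e : Fin N ≃ Fin N, ∀ i, (leadingProlate_isHermitian N M h W).eigenvalues i =
      prolateEigenvalue N M h W (e i) := by
  refine ⟨(Fintype.equivOfCardEq (Fintype.card_fin _)).symm.trans
    (finCongr (Fintype.card_fin N)), fun i => ?_⟩
  rfl

theorem prolateEigenvalue_antitone (N M : ℕ) (h : N ≤ M) (W : ℝ) :
    Antitone (prolateEigenvalue N M h W) := fun _ _ hab =>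
  (leadingProlate_isHermitian N M h W).eigenvalues₀_antitone hab

theorem theorem1 (M N K : ℕ) (hN : 0 < N) (hNM : N < M) (W : ℝ)
    (hW : W = (2 * (K : ℝ) + 1) / (2 * (M : ℝ))) (hW2 : W < 1 / 2)
    (ε : ℝ) (hε0 : 0 < ε) (hε1 : ε < 1 / 2) :
    (∀ ℓ : Fin N, (ℓ : ℤ) ≤ 2 * ⌊(N : ℝ) * W⌋ - ⌊transitionWidth N M ε⌋ →
        1 - ε ≤ prolateEigenvalue N M hNM.le W ℓ) ∧
    (∀ ℓ : Fin N, 2 * ⌊(N : ℝ) * W⌋ + ⌊transitionWidth N M ε⌋ + 1 ≤ (ℓ : ℤ) →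
        prolateEigenvalue N M hNM.le W ℓ ≤ ε) ∧
    ({ℓ : Fin N | ε < prolateEigenvalue N M hNM.le W ℓ ∧
        prolateEigenvalue N M hNM.le W ℓ < 1 - ε}.ncard : ℝ) ≤ 2 * transitionWidth N M ε := by
  -- the block beyond `N` has `P + 1 > 0` rows
  obtain ⟨P, rfl⟩ := Nat.exists_eq_add_of_lt hNM
  have hK : 2 * K + 1 ≤ N + (P + 1) := by
    rw [hW, div_lt_iff₀ (by positivity)] at hW2
    have : (2 * K + 1 : ℝ) < ((N + P + 1 : ℕ) : ℝ) := by linarith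
    exact_mod_cast this.le
  have hA := leadingProlate_isHermitian N (N + P + 1) hNM.le W
  obtain ⟨e, he⟩ := exists_equiv_prolateEigenvalue N (N + P + 1) hNM.le W
  have hanti := prolateEigenvalue_antitone N (N + P + 1) hNM.le W
  have hC := leadingProlate_eq (P := P + 1) hK hW hNM.le
  have hsum := sum_eigenvalues_leadingProlate N (N + P + 1) hNM.le W
  have hbd : ∀ i, 0 ≤ hA.eigenvalues i ∧ hA.eigenvalues i ≤ 1 := fun i => by
    have := eigenvalues_mul_one_sub_nonneg hA _ hC i
    constructor <;> nlinarith
  have hD := location_error_add_two_le (P := P + 1) hN P.succ_pos hK hW hNM.le hε0 hε1 rfl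
  have hup := card_gt_le_sum hε0 hε1 hA.eigenvalues (fun i => (hbd i).1) (fun i => (hbd i).2)
  have hlo := sum_le_card_ge hε0 hε1 hA.eigenvalues (fun i => (hbd i).1) (fun i => (hbd i).2)
  have hcard : ∀ p : ℝ → Prop, ∀ [DecidablePred p], (univ.filter fun i => p (hA.eigenvalues i)).card =
      (univ.filter fun i => p (prolateEigenvalue N (N + P + 1) hNM.le W i)).card := fun p _ =>
    card_equiv e fun i => by simp only [mem_filter, mem_univ, true_and, he]
  have hcu := hcard (fun y => ε < y)
  have hcl := hcard (fun y => 1 - ε ≤ y)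
  set D := (∑ i, hA.eigenvalues i * (1 - hA.eigenvalues i)) / (1 - ε) +
    (1 - 2 * ε) * (univ.filter fun i => ε < hA.eigenvalues i ∧ hA.eigenvalues i < 1 - ε).card
    with hDdef
  rw [hsum, hcu] at hup
  rw [hsum, hcl] at hlo
  change D + 2 ≤ transitionWidth N (N + P + 1) ε at hD
  set R := transitionWidth N (N + P + 1) ε with hR
  have hD0 : 0 ≤ D := by
    refine add_nonneg (div_nonneg (sum_nonneg fun i _ => ?_) (by linarith))
      (mul_nonneg (by linarith) (by positivity))
    exact eigenvalues_mul_one_sub_nonneg hA _ hC i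
  have hR1 := Int.lt_floor_add_one R
  have hF1 := Int.floor_le ((N : ℝ) * W)
  have hF2 := Int.lt_floor_add_one ((N : ℝ) * W)
  -- `2 N W` lies in `[2 ⌊N W⌋, 2 ⌊N W⌋ + 2)`; the two units of slack in `D + 2 ≤ R` cover this
  -- interval and the fractional part of `R`
  have c1 : ∀ ℓ : Fin N, (ℓ : ℤ) ≤ 2 * ⌊(N : ℝ) * W⌋ - ⌊R⌋ →
      1 - ε ≤ prolateEigenvalue N (N + P + 1) hNM.le W ℓ := fun ℓ hℓ => by
    refine le_of_lt_card_ge hanti ?_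
    have : ((ℓ : ℤ) : ℝ) ≤ 2 * ⌊(N : ℝ) * W⌋ - ⌊R⌋ := by exact_mod_cast hℓ
    rw [← Nat.cast_lt (α := ℝ)]
    push_cast at this
    linarith
  have c2 : ∀ ℓ : Fin N, 2 * ⌊(N : ℝ) * W⌋ + ⌊R⌋ + 1 ≤ (ℓ : ℤ) →
      prolateEigenvalue N (N + P + 1) hNM.le W ℓ ≤ ε := fun ℓ hℓ => by
    refine le_of_card_gt_le hanti ?_
    have h1 : (2 * ⌊(N : ℝ) * W⌋ + ⌊R⌋ + 1 : ℝ) ≤ ((ℓ : ℤ) : ℝ) := by exact_mod_cast hℓ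
    push_cast at h1
    have h2 : ((univ.filter fun i => ε < prolateEigenvalue N (N + P + 1) hNM.le W i).card : ℝ) <
        (ℓ : ℕ) + 1 := by linarith
    exact Nat.lt_succ_iff.1 (by exact_mod_cast h2)
  refine ⟨c1, c2, ?_⟩
  have hr0 : 0 ≤ ⌊R⌋ := Int.floor_nonneg.2 (by linarith)
  have h3 := ncard_le_of_between (S := {ℓ : Fin N | ε < prolateEigenvalue N (N + P + 1) hNM.le W ℓ ∧
    prolateEigenvalue N (N + P + 1) hNM.le W ℓ < 1 - ε}) (F := ⌊(N : ℝ) * W⌋) hr0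
    fun i hi => ⟨by
      by_contra! hc
      exact absurd (c1 i hc) (not_le.2 hi.2), by
      by_contra! hc
      exact absurd (c2 i hc) (not_le.2 hi.1)⟩
  have h4 : ((Set.ncard {ℓ : Fin N | ε < prolateEigenvalue N (N + P + 1) hNM.le W ℓ ∧
    prolateEigenvalue N (N + P + 1) hNM.le W ℓ < 1 - ε} : ℕ) : ℝ) ≤ 2 * ⌊R⌋ := by exact_mod_cast h3
  linarith [Int.floor_le R]
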